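/- Let $\mathbb K$ be a field, and let $f_0,f_1,f_2\in\mathbb K[T_0,T_1]$ be homogeneous of degree $d$ with $\gcd(f_0,f_1,f_2)=1$ (a parametrization of a plane rational curve). Let $\mathcal K$ be its moving curve ideal, that is, the kernel of $$\psi:\mathbb K[T_0,T_1,Z_0,Z_1,Z_2]\to\mathbb K[T_0,T_1,s],\qquad T_i\mapsto T_i,\quad Z_j\mapsto f_j s .$$ A $\mu$-basis of a triple of polynomials is a basis of its $\mathbb K[T_0,T_1]$-module of syzygies consisting of two vectors, each with homogeneous entries of a common degree, ordered by degree. Let $p=(p_0,p_1,p_2)$, $q=(q_0,q_1,q_2)$ be a $\mu$-basis of $(f_0,f_1,f_2)$, of degrees $\mu\le d-\mu$, and let $A=(A_0,A_1,A_2)$, $B=(B_0,B_1,B_2)$ be a $\mu$-basis of $(p_0,p_1,p_2)$, of degrees $\mu_1\le\mu_2$, where $\mu_1+\mu_2=\mu$. We also write $q=q_0Z_0+q_1Z_1+q_2Z_2\in\mathcal K$. With $\deg T_i=(1,0)$ and $\deg Z_j=(0,1)$ the ring $\mathbb K[T_0,T_1,Z_0,Z_1,Z_2]$ is bigraded. If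 a bihomogeneous $F$ lies in the ideal generated by $p_0,p_1,p_2$ in $\mathbb K[T_0,T_1,Z_0,Z_1,Z_2]$, write $F=p_0F^{(0)}+p_1F^{(1)}+p_2F^{(2)}$ with $F^{(0)},F^{(1)},F^{(2)}$ bihomogeneous of a common bidegree, and set $$D_A(F)=\det\begin{pmatrix}F^{(0)}&F^{(1)}&F^{(2)}\\ Z_0&Z_1&Z_2\\ B_0&B_1&B_2\end{pmatrix},\qquad D_B(F)=\det\begin{pmatrix}F^{(0)}&F^{(1)}&F^{(2)}\\ Z_0&Z_1&Z_2\\ A_0&A_1&A_2\end{pmatrix}.$$ These polynomials depend on the chosen presentation of $F$; otherwise (if $F\notin\langle p_0,p_1,p_2\rangle$) they are not defined. **Theorem.** Assume $\mu_1>0$, and let $S$ be the set of pairs $(a,b)$ of integers $a,b\ge 0$ with either $b\ge1$ and $d-\mu-a\mu_1-b\mu_2\ge\mu-1$, or $b=0$ and $d-\mu-a\mu_1\ge\mu+\mu_2-\mu_1-1$. 1. For every $(a,b)\in S$ the iterate $D_A^aD_B^b(q)$, formed by applying to $q$ first $a$ times $D_A$ and then $b$ times $D_B$, is defined, whatever presentations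 are chosen on the way. 2. For each $(a,b)\in S$ let $G_{a,b}$ be any value of $D_A^aD_B^b(q)$, for any choice of presentations; here the $a$ operators $D_A$ and the $b$ operators $D_B$ may even be applied in any order for which all steps are defined. Then the polynomials $G_{a,b}$, $(a,b)\in S$, are pairwise distinct and are all contained in one minimal generating set of $\mathcal K$ consisting of bihomogeneous polynomials. -/

import Mathlib

noncomputable section

namespace MovingCurve

open MvPolynomial

/-- The polynomial ring `K[T₀, T₁]`. -/
abbrev TPoly (K : Type*) [Field K] := MvPolynomial (Fin 2) K

/-- The polynomial ring `K[T₀, T₁, Z₀, Z₁, Z₂]`; `T i` is `X (Sum.inl i)`, `Z j` is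
`X (Sum.inr j)`. -/
abbrev TZPoly (K : Type*) [Field K] := MvPolynomial (Fin 2 ⊕ Fin 3) K

section

variable {K : Type*} [Field K]

/-- The inclusion `K[T] → K[T, Z]`. -/
def incl : TPoly K →ₐ[K] TZPoly K := rename Sum.inl

/-- `F` is bihomogeneous of bidegree `m`, where `deg Tᵢ = (1, 0)` and `deg Zⱼ = (0, 1)`. -/
def IsBihomogeneous (F : TZPoly K) (m : ℕ × ℕ) : Prop :=
  IsWeightedHomogeneous (Sum.elim (fun _ => ((1, 0) : ℕ × ℕ)) (fun _ => ((0, 1) : ℕ × ℕ))) F m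

/-- The `K[T]`-module of syzygies of a triple `f`. -/
def syzygies (f : Fin 3 → TPoly K) : Submodule (TPoly K) (Fin 3 → TPoly K) :=
  LinearMap.ker (Fintype.linearCombination (TPoly K) f)

/-- `(p, q)` is a `μ`-basis of the triple `f`, with degrees `m ≤ n`: the entries of `p` are
homogeneous of degree `m`, those of `q` of degree `n`, and `p, q` form a basis of the
`K[T]`-module of syzygies of `f`. -/
structure IsMuBasis (f : Fin 3 → TPoly K) (m n : ℕ) (p q : Fin 3 → TPoly K) : Prop where
  le : m ≤ n
  homogeneous_fst : ∀ i, (p i).IsHomogeneous m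
  homogeneous_snd : ∀ i, (q i).IsHomogeneous n
  linearIndependent : LinearIndependent (TPoly K) ![p, q]
  span_eq : Submodule.span (TPoly K) {p, q} = syzygies f

/-- The map `ψ : K[T, Z] → K[T][s]`, `Tᵢ ↦ Tᵢ`, `Zⱼ ↦ fⱼ s`, whose image is the Rees algebra
of the ideal generated by the entries of `f`. -/
def reesMap (f : Fin 3 → TPoly K) : TZPoly K →ₐ[K] Polynomial (TPoly K) :=
  aeval (Sum.elim (fun i => Polynomial.C (X i)) (fun j => Polynomial.C (f j) * Polynomial.X))

/-- The moving curve ideal of `f`, the defining ideal of the Rees algebra. -/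
def movingCurveIdeal (f : Fin 3 → TPoly K) : Ideal (TZPoly K) :=
  RingHom.ker (reesMap f)

/-- The form `h₀ Z₀ + h₁ Z₁ + h₂ Z₂` attached to a triple `h` (a moving line). -/
def movingLine (h : Fin 3 → TPoly K) : TZPoly K :=
  ∑ j, incl (h j) * X (Sum.inr j)

/-- The names of the two determinantal operators `D_A` and `D_B`. -/
inductive DetOp
  | DA
  | DB

/-- The last row of the determinant: `D_A` uses the triple `B`, and `D_B` uses `A`. -/
def DetOp.row (A B : Fin 3 → TPoly K) : DetOp → Fin 3 → TPoly K
  | .DA => B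
  | .DB => A

/-- `G` is a value of the operator at `F`: for some presentation
`F = p₀ F⁽⁰⁾ + p₁ F⁽¹⁾ + p₂ F⁽²⁾` with `F⁽⁰⁾, F⁽¹⁾, F⁽²⁾` bihomogeneous of a common bidegree,
`G` is the determinant with rows `(F⁽⁰⁾, F⁽¹⁾, F⁽²⁾)`, `(Z₀, Z₁, Z₂)` and `B` (for `D_A`)
or `A` (for `D_B`). The value depends on the presentation. -/
def IsValue (p A B : Fin 3 → TPoly K) (D : DetOp) (F G : TZPoly K) : Prop :=
  ∃ H : Fin 3 → TZPoly K,
    (∃ m : ℕ × ℕ, ∀ l, IsBihomogeneous (H l) m) ∧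
    F = ∑ l, incl (p l) * H l ∧
    G = Matrix.det !![H 0, H 1, H 2;
          X (Sum.inr 0), X (Sum.inr 1), X (Sum.inr 2);
          incl (D.row A B 0), incl (D.row A B 1), incl (D.row A B 2)]

/-- `G` is a value at `F` of the iterated operator which applies the entries of the list one
after the other, the head of the list first. -/
def IsIterate (p A B : Fin 3 → TPoly K) : List DetOp → TZPoly K → TZPoly K → Prop
  | [], F, G => G = F
  | D :: w, F, G => ∃ H, IsValue p A B D F H ∧ IsIterate p A B w H G

/-- The iterated operator (head of the list first) is defined at `F`: every step has a value,
whatever values were chosen at the previous steps. -/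
def IterateDefined (p A B : Fin 3 → TPoly K) : List DetOp → TZPoly K → Prop
  | [], _ => True
  | D :: w, F => (∃ H, IsValue p A B D F H) ∧
      ∀ H, IsValue p A B D F H → IterateDefined p A B w H

/-- The list for `D_A^a D_B^b`: first `a` times `D_A`, then `b` times `D_B`. -/
def word (a b : ℕ) : List DetOp :=
  List.replicate a DetOp.DA ++ List.replicate b DetOp.DB

/-- `M` is a minimal generating set of the ideal `I`, consisting of bihomogeneous
polynomials. -/
structure IsMinimalGenerators (I : Ideal (TZPoly K)) (M : Set (TZPoly K)) : Prop where
  bihomogeneous : ∀ F ∈ M, ∃ m, IsBihomogeneous F m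
  span_eq : Ideal.span M = I
  minimal : ∀ N ⊆ M, Ideal.span N = I → N = M

end

/-- The range of the exponents `(a, b)`. -/
def InRange (d μ μ₁ μ₂ a b : ℕ) : Prop :=
  (1 ≤ b ∧ (d : ℤ) - μ - a * μ₁ - b * μ₂ ≥ (μ : ℤ) - 1) ∨
  (b = 0 ∧ (d : ℤ) - μ - a * μ₁ ≥ (μ : ℤ) + μ₂ - μ₁ - 1)

end MovingCurve

end

noncomputable section

namespace MovingCurve

open MvPolynomial

/-! ### Divisibility by way of coprime families. -/

section Coprime

/-! Substituting `Z = xA + yB` sends `K[T, Z]` to `K[T][x, y]` and kills the moving line `p`. By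
Hilbert–Burch, `A × B` is a nonzero constant `c` times `p`, so expanding the determinants shows that
there `D_A` is multiplication by `cx` and `D_B` by `-cy`, whatever the presentation and the order.
The line `q` becomes `L = αx + βy` with `α = A · q`, `β = B · q`. Hence every value of the iterate
is `c^a (-c)^b x^a y^b L` on the scroll.

Since `αB - βA` is a nonzero constant times `f`, the moving curve ideal `I` is exactly the preimage
of `(L)` (`lineForm_dvd_scroll_of_mem`, `mem_of_lineForm_dvd_scroll`). Take an element of `I`,
divide its image by `L` and set `T = 0`. This annihilates `⟨T, Z⟩I`, because `A` and `B` have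
positive degree, and sends the iterates to nonzero multiples of the distinct monomials `x^a y^b`.
They are therefore linearly independent in `I/⟨T, Z⟩I`, and graded Nakayama extends them to a
minimal generating set.

That the iterates are defined is a regularity statement: a dimension count with the syzygies `A, B`
shows that `(p₀, p₁, p₂)` contains every form of degree at least `μ + μ₂ - 1`. The set `S` says that
the degree in `T` is still this large just before the last operator is applied. -/

theorem dvd_of_forall_dvd_mul {R ι : Type*} [CommRing R] [IsDomain R]
    [UniqueFactorizationMonoid R] [Fintype ι] {f : ι → R}
    (hf : ∀ g, (∀ i, g ∣ f i) → IsUnit g) {q r : R} (h : ∀ i, q ∣ f i * r) : q ∣ r := by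
  classical
  let : StrongNormalizationMonoid R :=
    UniqueFactorizationMonoid.strongNormalizationMonoid
  let : StrongNormalizedGCDMonoid R :=
    UniqueFactorizationMonoid.toStrongNormalizedGCDMonoid R
  have h1 : q ∣ Finset.univ.gcd fun i => f i * r := Finset.dvd_gcd fun i _ => h i
  rw [Finset.gcd_mul_right] at h1
  have h2 : IsUnit (Finset.univ.gcd f) := hf _ fun i => Finset.gcd_dvd (Finset.mem_univ i)
  exact (normalize_associated r).dvd_iff_dvd_right.mp ((h2.dvd_mul_left).mp h1)

theorem dvd_of_dvd_mul_of_isRelPrime {R : Type*} [CommRing R] [IsDomain R]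
    [UniqueFactorizationMonoid R] {a b q r : R} (hab : IsRelPrime a b) (ha : q ∣ a * r)
    (hb : q ∣ b * r) : q ∣ r :=
  dvd_of_forall_dvd_mul (f := ![a, b]) (fun _ hg => hab (hg 0) (hg 1))
    (by simpa [Fin.forall_fin_two] using ⟨ha, hb⟩)

theorem isRelPrime_C {R σ : Type*} [CommRing R] [IsDomain R] {a b : R} (hab : IsRelPrime a b) :
    IsRelPrime (C a : MvPolynomial σ R) (C b) := by
  -- Divisors of a nonzero constant are constants; coprime `a`, `b` cannot both vanish.
  wlog ha : a ≠ 0 generalizing a b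
  · by_cases hb : b = 0
    · subst hb
      push Not at ha
      subst ha
      exact absurd (hab dvd_rfl dvd_rfl) not_isUnit_zero
    · exact (this hab.symm hb).symm
  intro h h1 h2
  obtain ⟨c, hc, rfl⟩ := (dvd_C_iff_exists ha).mp h1
  refine (hab hc ?_).map C
  rw [C_dvd_iff_dvd_coeff] at h2
  simpa using h2 0

end Coprime

/-! ### Cross products over a domain. -/

section Cross

variable {R : Type*} [CommRing R] [IsDomain R]

open Matrix

/-- Over the fraction field, the vectors orthogonal to `u` and `v` form the line through `u × v`.
Clearing denominators costs a factor `(u × v) k ^ 2`, which is cancelled. -/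
theorem cross_eq_zero_of_orthogonal {u v x y : Fin 3 → R} (huv : u ⨯₃ v ≠ 0)
    (hux : u ⬝ᵥ x = 0) (hvx : v ⬝ᵥ x = 0) (huy : u ⬝ᵥ y = 0) (hvy : v ⬝ᵥ y = 0) :
    x ⨯₃ y = 0 := by
  have key : ∀ z : Fin 3 → R, u ⬝ᵥ z = 0 → v ⬝ᵥ z = 0 →
      ∀ i j, (u ⨯₃ v) i * z j = (u ⨯₃ v) j * z i := by
    intro z hu hv i j
    simp only [dotProduct, Fin.sum_univ_three] at hu hv
    fin_cases i <;> fin_cases j <;> simp [cross_apply]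
    · linear_combination v 2 * hu - u 2 * hv
    · linear_combination u 1 * hv - v 1 * hu
    · linear_combination u 2 * hv - v 2 * hu
    · linear_combination v 0 * hu - u 0 * hv
    · linear_combination v 1 * hu - u 1 * hv
    · linear_combination u 0 * hv - v 0 * hu
  obtain ⟨k, hk⟩ := Function.ne_iff.mp huv
  have par : ∀ i j, x i * y j = x j * y i := by
    intro i j
    have hk : (u ⨯₃ v) k ≠ 0 := hk
    apply mul_left_cancel₀ (pow_ne_zero 2 hk)
    linear_combination (u ⨯₃ v) k * y j * key x hux hvx k i
      + (u ⨯₃ v) i * x k * key y huy hvy k j - (u ⨯₃ v) k * y i * key x hux hvx k j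
      - (u ⨯₃ v) j * x k * key y huy hvy k i
  ext i
  fin_cases i <;> simp [cross_apply, par]

theorem cross_ne_zero_of_linearIndependent {u v : Fin 3 → R}
    (h : LinearIndependent R ![u, v]) : u ⨯₃ v ≠ 0 := by
  intro h0
  rw [LinearIndependent.pair_iff] at h
  -- If the cross product vanishes, each of these is a linear relation between `u` and `v`, and its
  -- coefficients force `u = 0`.
  have par : ∀ k, v k • u + (-u k) • v = 0 := by
    have e : ∀ i, (u ⨯₃ v) i = 0 := fun i => by simp [h0]
    have e0 := e 0
    have e1 := e 1
    have e2 := e 2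
    simp only [cross_apply] at e0 e1 e2
    simp at e0 e1 e2
    intro k
    ext i
    fin_cases k <;> fin_cases i <;> simp <;> grind
  have hv : u = 0 := by
    ext k
    simpa using (h _ _ (par k)).2
  have := (h 1 0 (by simp [hv])).1
  exact one_ne_zero this

end Cross

/-! ### Proportional triples and the Hilbert–Burch relation for a `μ`-basis. -/

section Forms

variable {K : Type*} [Field K]

open Matrix

/-- Parallel triples differ by a rational function. Coprimality of `f` makes it a polynomial, and
equality of degrees makes it a constant. -/
theorem eq_C_mul_of_cross_eq_zero {d : ℕ} {f g : Fin 3 → TPoly K}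
    (hf : ∀ i, (f i).IsHomogeneous d) (hg : ∀ i, (g i).IsHomogeneous d)
    (hgcd : ∀ h : TPoly K, (∀ i, h ∣ f i) → IsUnit h) (hfg : f ⨯₃ g = 0) :
    ∃ c : K, ∀ i, g i = C c * f i := by
  have par : ∀ i j, f i * g j = f j * g i := by
    have e : ∀ i, (f ⨯₃ g) i = 0 := fun i => by simp [hfg]
    have e0 := e 0
    have e1 := e 1
    have e2 := e 2
    simp only [cross_apply] at e0 e1 e2
    simp at e0 e1 e2
    intro i j
    fin_cases i <;> fin_cases j <;> simp <;> grind
  obtain ⟨k, hk⟩ : ∃ k, f k ≠ 0 := by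
    by_contra! h0
    exact not_isUnit_zero (hgcd 0 fun i => by simp [h0])
  obtain ⟨e, he⟩ : f k ∣ g k :=
    dvd_of_forall_dvd_mul hgcd fun i => ⟨g i, (par i k)⟩
  have hge : ∀ i, g i = e * f i := fun i =>
    mul_left_cancel₀ hk (by rw [par k i, he]; ring)
  obtain ⟨c, rfl⟩ : ∃ c, e = C c := by
    by_cases he0 : e = 0
    · exact ⟨0, by simp [he0]⟩
    · have h1 := totalDegree_mul_of_isDomain he0 hk
      rw [← hge, (hg k).totalDegree (by rw [hge]; exact mul_ne_zero he0 hk),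
        (hf k).totalDegree hk] at h1
      exact ⟨_, totalDegree_eq_zero_iff_eq_C.mp (by omega)⟩
  exact ⟨c, hge⟩

theorem mem_syzygies {f h : Fin 3 → TPoly K} : h ∈ syzygies f ↔ h ⬝ᵥ f = 0 := by
  simp [syzygies, Fintype.linearCombination_apply, dotProduct]

namespace IsMuBasis

variable {f p q : Fin 3 → TPoly K} {m n : ℕ}

theorem fst_dotProduct (h : IsMuBasis f m n p q) : p ⬝ᵥ f = 0 :=
  mem_syzygies.mp (h.span_eq ▸ Submodule.subset_span (by simp))

theorem snd_dotProduct (h : IsMuBasis f m n p q) : q ⬝ᵥ f = 0 :=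
  mem_syzygies.mp (h.span_eq ▸ Submodule.subset_span (by simp))

/-- If `p = g r`, then `r` is itself a syzygy, so `r = a p + b q`. Comparing coefficients of `p` in
`p = g r` gives `g a = 1`. -/
theorem isUnit_of_forall_dvd_fst (h : IsMuBasis f m n p q) (g : TPoly K)
    (hg : ∀ i, g ∣ p i) : IsUnit g := by
  choose r hr using hg
  have hp : p = g • r := funext hr
  have hli := LinearIndependent.pair_iff.mp h.linearIndependent
  have hg0 : g ≠ 0 := by
    rintro rfl
    exact one_ne_zero (hli 1 0 (by simp [hp])).1
  have hrs : r ∈ syzygies f := by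
    have := h.fst_dotProduct
    rw [hp, smul_dotProduct, smul_eq_mul] at this
    exact mem_syzygies.mpr ((mul_eq_zero.mp this).resolve_left hg0)
  rw [← h.span_eq, Submodule.mem_span_pair] at hrs
  obtain ⟨a, b, hab⟩ := hrs
  have := (hli (g * a - 1) (g * b) (by
    rw [sub_smul, mul_smul, mul_smul, one_smul]
    nth_rewrite 2 [hp]
    rw [← hab]
    module)).1
  exact IsUnit.of_mul_eq_one a (sub_eq_zero.mp this)

/-- Both `p × q` and `f` are orthogonal to `p` and `q`, hence parallel, and they have the same
degree. -/
theorem exists_cross_eq {c : ℕ} (h : IsMuBasis f m n p q) (hf : ∀ i, (f i).IsHomogeneous c)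
    (hgcd : ∀ h : TPoly K, (∀ i, h ∣ f i) → IsUnit h) (hc : c = m + n) :
    ∃ a : K, a ≠ 0 ∧ ∀ i, (p ⨯₃ q) i = C a * f i := by
  have hne := cross_ne_zero_of_linearIndependent h.linearIndependent
  obtain ⟨a, ha⟩ := eq_C_mul_of_cross_eq_zero (g := p ⨯₃ q) hf (fun i => by
      subst hc
      fin_cases i <;> simp only [cross_apply] <;>
        exact ((h.homogeneous_fst _).mul (h.homogeneous_snd _)).sub
          ((h.homogeneous_fst _).mul (h.homogeneous_snd _))) hgcd
    (cross_eq_zero_of_orthogonal hne h.fst_dotProduct h.snd_dotProduct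
      (dot_self_cross p q) (dot_cross_self p q))
  refine ⟨a, ?_, ha⟩
  rintro rfl
  exact hne (funext fun i => by simpa using ha i)

end IsMuBasis

end Forms

/-! ### Regularity of the ideal generated by the entries of `p`. -/

section Regularity

variable {K : Type*} [Field K]

/-- The forms of degree `n - s` in `K[T₀, T₁]`, and only `0` if `n < s`. -/
def shiftedForms (K : Type*) [Field K] (n s : ℕ) : Submodule K (TPoly K) :=
  restrictSupport K {e | e.degree + s = n}

theorem mem_shiftedForms {n s : ℕ} {g : TPoly K} :
    g ∈ shiftedForms K n s ↔ ∀ e, coeff e g ≠ 0 → e.degree + s = n := by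
  simp [shiftedForms, mem_restrictSupport_iff, Set.subset_def]

theorem mem_shiftedForms_of_isHomogeneous {n s : ℕ} {g : TPoly K} (hs : s ≤ n)
    (hg : g.IsHomogeneous (n - s)) : g ∈ shiftedForms K n s := by
  refine mem_shiftedForms.mpr fun e he => ?_
  have h1 : Finsupp.weight 1 e = n - s := hg he
  have h2 : e.degree = Finsupp.weight 1 e :=
    DFunLike.congr_fun (Finsupp.degree_eq_weight_one (R := ℕ)) e
  omega

theorem isHomogeneous_of_mem_shiftedForms {n s : ℕ} {g : TPoly K}
    (hg : g ∈ shiftedForms K n s) : g.IsHomogeneous (n - s) := by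
  intro e he
  have := mem_shiftedForms.mp hg e he
  have h2 : e.degree = Finsupp.weight 1 e :=
    DFunLike.congr_fun (Finsupp.degree_eq_weight_one (R := ℕ)) e
  omega

/-- The monomials of degree `n - s` are counted by the exponent of `T₀`. -/
def shiftedIndexEquiv (n s : ℕ) :
    {e : Fin 2 →₀ ℕ | e.degree + s = n} ≃ Fin (n + 1 - s) where
  toFun e := ⟨e.1 0, by
    have h := e.2
    simp only [Set.mem_ofPred_eq, Finsupp.degree_eq_sum, Fin.sum_univ_two] at h
    omega⟩
  invFun i := ⟨Finsupp.equivFunOnFinite.symm ![i, n - s - i], by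
    simp only [Set.mem_ofPred_eq, Finsupp.degree_eq_sum, Fin.sum_univ_two]
    simp
    omega⟩
  left_inv e := by
    have h := e.2
    simp only [Set.mem_ofPred_eq, Finsupp.degree_eq_sum, Fin.sum_univ_two] at h
    ext i
    fin_cases i <;> simp
    omega
  right_inv i := by simp

instance (n s : ℕ) : FiniteDimensional K (shiftedForms K n s) :=
  have : Finite {e : Fin 2 →₀ ℕ | e.degree + s = n} := .of_equiv _ (shiftedIndexEquiv n s).symm
  (basisRestrictSupport K {e : Fin 2 →₀ ℕ | e.degree + s = n}).finiteDimensional_of_finite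

theorem finrank_shiftedForms (n s : ℕ) :
    Module.finrank K (shiftedForms K n s) = n + 1 - s := by
  rw [shiftedForms, Module.finrank_eq_nat_card_basis
    (basisRestrictSupport K {e : Fin 2 →₀ ℕ | e.degree + s = n}),
    Nat.card_congr (shiftedIndexEquiv n s), Nat.card_fin]

attribute [local instance] MvPolynomial.gradedAlgebra in
-- This makes the coefficients of a homogeneous syzygy homogeneous. The same `u'` serves every `a`
-- of degree `s`, hence all entries of a basis vector at once.
theorem exists_shiftedForms_homogeneousComponent (n s : ℕ) (u : TPoly K) :
    ∃ u' ∈ shiftedForms K n s, ∀ a : TPoly K, a.IsHomogeneous s →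
      homogeneousComponent n (u * a) = u' * a := by
  have e : ∀ (i : ℕ) (v : TPoly K), homogeneousComponent i v =
      (DirectSum.decompose (homogeneousSubmodule (Fin 2) K) v i : TPoly K) := fun i v =>
    (decomposition.decompose'_apply v i).symm
  by_cases hs : s ≤ n
  · refine ⟨homogeneousComponent (n - s) u,
      mem_shiftedForms_of_isHomogeneous hs (homogeneousComponent_isHomogeneous _ _),
      fun a (ha : a ∈ homogeneousSubmodule (Fin 2) K s) => ?_⟩
    rw [e, e, DirectSum.coe_decompose_mul_of_right_mem_of_le _ ha hs]
  · exact ⟨0, zero_mem _, fun a (ha : a ∈ homogeneousSubmodule (Fin 2) K s) => by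
      rw [e, DirectSum.coe_decompose_mul_of_right_mem_of_not_le _ ha hs, zero_mul]⟩

/-- The ideal generated by the entries of `p` contains all forms of degree `≥ μ + μ₂ - 1`. -/
theorem IsMuBasis.exists_presentation {μ μ₁ μ₂ : ℕ} {p A B : Fin 3 → TPoly K}
    (hAB : IsMuBasis p μ₁ μ₂ A B) (hp : ∀ i, (p i).IsHomogeneous μ) (hμ : μ = μ₁ + μ₂)
    (hμ₂ : 0 < μ₂) {n : ℕ} (hn : μ + μ₂ ≤ n + 1) {g : TPoly K} (hg : g.IsHomogeneous n) :
    ∃ h : Fin 3 → TPoly K, (∀ l, (h l).IsHomogeneous (n - μ)) ∧ g = ∑ l, p l * h l := by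
  let L : (Fin 3 → shiftedForms K (n - μ) 0) →ₗ[K] TPoly K :=
    ∑ l, (LinearMap.mulLeft K (p l)) ∘ₗ (shiftedForms K (n - μ) 0).subtype ∘ₗ LinearMap.proj l
  have hL : ∀ h, L h = ∑ l, p l * (h l : TPoly K) := fun h => by simp [L]
  let P : (shiftedForms K (n - μ) μ₁ × shiftedForms K (n - μ) μ₂) →ₗ[K] (Fin 3 → TPoly K) :=
    LinearMap.pi fun l => LinearMap.coprod
      (LinearMap.mulRight K (A l) ∘ₗ (shiftedForms K (n - μ) μ₁).subtype)
      (LinearMap.mulRight K (B l) ∘ₗ (shiftedForms K (n - μ) μ₂).subtype)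
  have hP : ∀ u l, P u l = u.1 * A l + u.2 * B l := fun u l => by simp [P]
  let J : (Fin 3 → shiftedForms K (n - μ) 0) →ₗ[K] (Fin 3 → TPoly K) :=
    LinearMap.pi fun l => (shiftedForms K (n - μ) 0).subtype ∘ₗ LinearMap.proj l
  have hJ : Function.Injective J := fun a b hab => by
    ext l : 2
    exact congrFun hab l
  -- Syzygies of `p` of degree `n - μ` are combinations `u A + v B` with `u`, `v` forms of degrees
  -- `n - μ - μ₁` and `n - μ - μ₂`.
  have hker : (LinearMap.ker L).map J ≤ LinearMap.range P := by
    rintro _ ⟨h, hh, rfl⟩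
    have hsyz : (J h) ∈ syzygies p := by
      rw [mem_syzygies, dotProduct, ← LinearMap.mem_ker.mp hh, hL]
      exact Finset.sum_congr rfl fun l _ => mul_comm _ _
    rw [← hAB.span_eq, Submodule.mem_span_pair] at hsyz
    obtain ⟨u, v, huv⟩ := hsyz
    obtain ⟨u', hu', hu⟩ := exists_shiftedForms_homogeneousComponent (n - μ) μ₁ u
    obtain ⟨v', hv', hv⟩ := exists_shiftedForms_homogeneousComponent (n - μ) μ₂ v
    refine ⟨(⟨u', hu'⟩, ⟨v', hv'⟩), funext fun l => ?_⟩
    have hl : (J h l).IsHomogeneous (n - μ) := by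
      simpa using! isHomogeneous_of_mem_shiftedForms (h l).2
    rw [hP, ← homogeneousComponent_eq_self hl, ← huv]
    simp [hu _ (hAB.homogeneous_fst l), hv _ (hAB.homogeneous_snd l)]
  have h1 : Module.finrank K (LinearMap.ker L) ≤ (n - μ + 1 - μ₁) + (n - μ + 1 - μ₂) := by
    rw [← finrank_shiftedForms (K := K) (n - μ) μ₁, ← finrank_shiftedForms (K := K) (n - μ) μ₂,
      ← Module.finrank_prod, ((LinearMap.ker L).equivMapOfInjective J hJ).finrank_eq]
    exact (Submodule.finrank_mono hker).trans (LinearMap.finrank_range_le P)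
  -- With `N = n - μ`, the image has dimension at least `3(N + 1) - (2(N + 1) - μ) = n + 1`, which
  -- is that of all forms of degree `n`. The bound `hn` gives `μ₂ ≤ N + 1`, so no subtraction in
  -- `h1` is truncated.
  have h2 := L.finrank_range_add_finrank_ker
  rw [Module.finrank_pi_fintype] at h2
  simp only [finrank_shiftedForms, Finset.sum_const, Finset.card_univ, Fintype.card_fin,
    smul_eq_mul] at h2
  have h3 : LinearMap.range L = shiftedForms K n 0 := by
    refine Submodule.eq_of_le_of_finrank_le ?_ ?_
    · rintro _ ⟨h, rfl⟩
      rw [hL]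
      refine Submodule.sum_mem _ fun l _ => mem_shiftedForms_of_isHomogeneous n.zero_le ?_
      have := (hp l).mul (isHomogeneous_of_mem_shiftedForms (h l).2)
      rw [Nat.sub_zero] at this ⊢
      convert this using 1
      omega
    · rw [finrank_shiftedForms]
      have := hAB.le
      omega
  have h4 : g ∈ LinearMap.range L := h3 ▸ mem_shiftedForms_of_isHomogeneous n.zero_le hg
  obtain ⟨h, rfl⟩ := h4
  exact ⟨fun l => h l, fun l => by simpa using isHomogeneous_of_mem_shiftedForms (h l).2, hL h⟩

end Regularity

/-! ### Bidegrees, presentations and the determinantal operators. -/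

section Bihomogeneous

variable {K : Type*} [Field K]

/-- The bidegrees of the variables. -/
abbrev bidegree : Fin 2 ⊕ Fin 3 → ℕ × ℕ :=
  Sum.elim (fun _ => (1, 0)) (fun _ => (0, 1))

theorem weight_bidegree (e : Fin 2 ⊕ Fin 3 →₀ ℕ) :
    Finsupp.weight bidegree e = (∑ i, e (Sum.inl i), ∑ j, e (Sum.inr j)) := by
  rw [Finsupp.weight_apply, Finsupp.sum_fintype _ _ (by simp)]
  ext <;> simp [Fin.sum_univ_three]

theorem IsBihomogeneous.mul {F G : TZPoly K} {m n k : ℕ × ℕ} (hF : IsBihomogeneous F m)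
    (hG : IsBihomogeneous G n) (h : m + n = k) : IsBihomogeneous (F * G) k :=
  h ▸ IsWeightedHomogeneous.mul hF hG

theorem isBihomogeneous_Z (j : Fin 3) :
    IsBihomogeneous (X (Sum.inr j) : TZPoly K) (0, 1) :=
  isWeightedHomogeneous_X _ _ _

theorem isBihomogeneous_incl {h : TPoly K} {n : ℕ} (hh : h.IsHomogeneous n) :
    IsBihomogeneous (incl h) (n, 0) := by
  intro e he
  obtain ⟨u, rfl, hu⟩ := coeff_rename_ne_zero _ _ _ he
  have h1 : Finsupp.weight 1 u = n := hh hu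
  have h2 : u.degree = Finsupp.weight 1 u :=
    DFunLike.congr_fun (Finsupp.degree_eq_weight_one (R := ℕ)) u
  rw [← h1, ← h2, Finsupp.weight_apply, Finsupp.sum_mapDomain_index (by simp)
    (by simp [add_smul])]
  simp [Finsupp.sum_fintype, Finsupp.degree_eq_sum]

theorem isBihomogeneous_movingLine {h : Fin 3 → TPoly K} {n : ℕ}
    (hh : ∀ i, (h i).IsHomogeneous n) : IsBihomogeneous (movingLine h) (n, 1) :=
  IsWeightedHomogeneous.sum _ _ _ fun j _ =>
    (isBihomogeneous_incl (hh j)).mul (isBihomogeneous_Z j) (by simp)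

theorem monomial_eq_incl_mul (e : Fin 2 ⊕ Fin 3 →₀ ℕ) (c : K) :
    (monomial e c : TZPoly K) = incl (∏ i, X i ^ e (Sum.inl i)) *
      (C c * ∏ j, X (Sum.inr j) ^ e (Sum.inr j)) := by
  rw [monomial_eq, Finsupp.prod_fintype _ _ (by simp), Fintype.prod_sum_type]
  simp only [incl, map_prod, map_pow, rename_X]
  ring

/-- A bihomogeneous polynomial of large degree in `T` has a bihomogeneous presentation. -/
theorem exists_bihomogeneous_presentation {μ n k : ℕ} {p : Fin 3 → TPoly K}
    (hp : ∀ g : TPoly K, g.IsHomogeneous n →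
      ∃ h : Fin 3 → TPoly K, (∀ l, (h l).IsHomogeneous (n - μ)) ∧ g = ∑ l, p l * h l)
    {F : TZPoly K} (hF : IsBihomogeneous F (n, k)) :
    ∃ H : Fin 3 → TZPoly K, (∀ l, IsBihomogeneous (H l) (n - μ, k)) ∧
      F = ∑ l, incl (p l) * H l := by
  rw [as_sum F]
  refine Finset.sum_induction _ (fun F => ∃ H : Fin 3 → TZPoly K,
    (∀ l, IsBihomogeneous (H l) (n - μ, k)) ∧ F = ∑ l, incl (p l) * H l) ?_ ?_ ?_
  · rintro _ _ ⟨H, hH, rfl⟩ ⟨H', hH', rfl⟩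
    refine ⟨H + H', fun l => (hH l).add (hH' l), ?_⟩
    simp [mul_add, Finset.sum_add_distrib]
  · exact ⟨0, fun l => isWeightedHomogeneous_zero _ _ _, by simp⟩
  · intro e he
    have hw := hF (mem_support_iff.mp he)
    rw [weight_bidegree, Prod.mk.injEq] at hw
    -- Only the `T`-part of each monomial needs a presentation; its `Z`-part and coefficient are
    -- carried along.
    obtain ⟨h, hh, hsum⟩ := hp (∏ i, X i ^ e (Sum.inl i)) (by
      rw [← hw.1]
      exact IsHomogeneous.prod _ _ _ fun i _ => by
        simpa using (isHomogeneous_X K i).pow (e (Sum.inl i)))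
    refine ⟨fun l => incl (h l) * (C (coeff e F) * ∏ j, X (Sum.inr j) ^ e (Sum.inr j)),
      fun l => ?_, ?_⟩
    · have hz : IsBihomogeneous (∏ j, X (Sum.inr j) ^ e (Sum.inr j) : TZPoly K) (0, k) := by
        have h0 : ∑ j : Fin 3, e (Sum.inr j) • ((0, 1) : ℕ × ℕ) = (0, k) := by
          ext <;> simp [← hw.2, Fin.sum_univ_three]
        exact h0 ▸ IsWeightedHomogeneous.prod (w := bidegree) Finset.univ
          (fun j => (X (Sum.inr j) : TZPoly K) ^ e (Sum.inr j)) _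
          fun j _ => (isBihomogeneous_Z j).pow (e (Sum.inr j))
      exact (isBihomogeneous_incl (hh l)).mul (IsWeightedHomogeneous.C_mul hz _) (by simp)
    · rw [monomial_eq_incl_mul, hsum, map_sum, Finset.sum_mul]
      simp only [map_mul, mul_assoc]

theorem isBihomogeneous_det {H : Fin 3 → TZPoly K} {m : ℕ × ℕ}
    (hH : ∀ l, IsBihomogeneous (H l) m) {r : Fin 3 → TPoly K} {n : ℕ}
    (hr : ∀ l, (r l).IsHomogeneous n) :
    IsBihomogeneous (Matrix.det !![H 0, H 1, H 2;
          X (Sum.inr 0), X (Sum.inr 1), X (Sum.inr 2);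
          incl (r 0), incl (r 1), incl (r 2)]) (m.1 + n, m.2 + 1) := by
  rw [Matrix.det_fin_three]
  have key : ∀ i j l, IsBihomogeneous (H i * X (Sum.inr j) * incl (r l)) (m.1 + n, m.2 + 1) :=
    fun i j l => ((hH i).mul (isBihomogeneous_Z j) rfl).mul (isBihomogeneous_incl (hr l))
      (by ext <;> simp)
  exact (((((key 0 1 2).sub (key 0 2 1)).sub (key 1 0 2)).add (key 1 2 0)).add
    (key 2 0 1)).sub (key 2 1 0)

theorem DetOp.isHomogeneous_row {p A B : Fin 3 → TPoly K} {μ₁ μ₂ : ℕ}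
    (hAB : IsMuBasis p μ₁ μ₂ A B) : ∀ D : DetOp, ∃ n, ∀ l, (D.row A B l).IsHomogeneous n
  | .DA => ⟨_, hAB.homogeneous_snd⟩
  | .DB => ⟨_, hAB.homogeneous_fst⟩

theorem IsIterate.exists_isBihomogeneous {p A B : Fin 3 → TPoly K} {μ₁ μ₂ : ℕ}
    (hAB : IsMuBasis p μ₁ μ₂ A B) : ∀ {w : List DetOp} {F G : TZPoly K},
    IsIterate p A B w F G → (∃ m, IsBihomogeneous F m) → ∃ m, IsBihomogeneous G m
  | [], _, _, h, hF => by
    obtain rfl : _ = _ := h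
    exact hF
  | D :: w, _, _, ⟨_, ⟨_, ⟨_, hm⟩, _, rfl⟩, hw⟩, _ =>
    have ⟨_, hn⟩ := D.isHomogeneous_row hAB
    hw.exists_isBihomogeneous hAB ⟨_, isBihomogeneous_det hm hn⟩

/-- How much `D_A` and `D_B` lower the degree in `T`. -/
def DetOp.drop (μ₁ μ₂ : ℕ) : DetOp → ℕ
  | .DA => μ₁
  | .DB => μ₂

theorem IsValue.isBihomogeneous {p A B : Fin 3 → TPoly K} {μ μ₁ μ₂ n k : ℕ}
    (hp : ∀ i, (p i).IsHomogeneous μ) (hAB : IsMuBasis p μ₁ μ₂ A B) (hμ : μ = μ₁ + μ₂)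
    {D : DetOp} {F G : TZPoly K} (h : IsValue p A B D F G) (hF : IsBihomogeneous F (n, k))
    (hF0 : F ≠ 0) : ∃ n', n' + D.drop μ₁ μ₂ = n ∧ IsBihomogeneous G (n', k + 1) := by
  obtain ⟨H, ⟨m, hm⟩, hFH, rfl⟩ := h
  have hF' : IsBihomogeneous F (μ + m.1, m.2) := by
    rw [hFH]
    exact IsWeightedHomogeneous.sum _ _ _ fun l _ =>
      (isBihomogeneous_incl (hp l)).mul (hm l) (by ext <;> simp)
  -- A nonzero polynomial has only one bidegree, so `F` determines that of its presentation.
  have hnk := IsWeightedHomogeneous.inj_right hF0 hF hF'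
  rw [Prod.mk.injEq] at hnk
  rw [hnk.1, hnk.2]
  cases D with
  | DA => exact ⟨m.1 + μ₂, by simp only [DetOp.drop]; omega,
      isBihomogeneous_det hm hAB.homogeneous_snd⟩
  | DB => exact ⟨m.1 + μ₁, by simp only [DetOp.drop]; omega,
      isBihomogeneous_det hm hAB.homogeneous_fst⟩

end Bihomogeneous

/-! ### The action of the operators on the scroll, and definedness of the iterates. -/

section Scroll

variable {K : Type*} [Field K]

open Matrix

/-- The parametrization `Z ↦ x A + y B` of the rational scroll `p = 0`. -/
def scroll (A B : Fin 3 → TPoly K) : TZPoly K →ₐ[K] MvPolynomial (Fin 2) (TPoly K) :=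
  aeval (Sum.elim (fun i => C (X i)) fun j => C (A j) * X 0 + C (B j) * X 1)

@[simp]
theorem scroll_T (A B : Fin 3 → TPoly K) (i : Fin 2) :
    scroll A B (X (Sum.inl i)) = C (X i) := by simp [scroll]

@[simp]
theorem scroll_Z (A B : Fin 3 → TPoly K) (j : Fin 3) :
    scroll A B (X (Sum.inr j)) = C (A j) * X 0 + C (B j) * X 1 := by simp [scroll]

@[simp]
theorem scroll_C (A B : Fin 3 → TPoly K) (c : K) : scroll A B (C c) = C (C c) :=
  (scroll A B).commutes c

@[simp]
theorem scroll_incl (A B : Fin 3 → TPoly K) (h : TPoly K) : scroll A B (incl h) = C h := by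
  induction h using MvPolynomial.induction_on with
  | C a => simp [incl]
  | add f g hf hg => simp [hf, hg]
  | mul_X f i hf => rw [map_mul, map_mul, hf]; simp [incl]

/-- The moving line `q` on the scroll. -/
def lineForm (A B q : Fin 3 → TPoly K) : MvPolynomial (Fin 2) (TPoly K) :=
  C (A ⬝ᵥ q) * X 0 + C (B ⬝ᵥ q) * X 1

theorem scroll_movingLine (A B q : Fin 3 → TPoly K) :
    scroll A B (movingLine q) = lineForm A B q := by
  simp [movingLine, lineForm, dotProduct, Fin.sum_univ_three]
  ring

/-- The operators act on the scroll as multiplication by these elements. -/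
def DetOp.factor (c : K) : DetOp → MvPolynomial (Fin 2) (TPoly K)
  | .DA => C (C c) * X 0
  | .DB => C (C (-c)) * X 1

/-- In the determinant the row `Z` becomes `xA + yB`. The last row `B` cancels `yB` and leaves `x
det(H, A, B) = x H · (A × B) = c x F`. With last row `A` one gets `y det(H, B, A) = -c y F`. -/
theorem IsValue.scroll_eq {p A B : Fin 3 → TPoly K} {c : K}
    (hc : ∀ i, (A ⨯₃ B) i = C c * p i) {D : DetOp} {F G : TZPoly K}
    (h : IsValue p A B D F G) : scroll A B G = D.factor c * scroll A B F := by
  obtain ⟨H, -, rfl, rfl⟩ := h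
  have h0 := congrArg (C : _ → MvPolynomial (Fin 2) (TPoly K)) (hc 0)
  have h1 := congrArg (C : _ → MvPolynomial (Fin 2) (TPoly K)) (hc 1)
  have h2 := congrArg (C : _ → MvPolynomial (Fin 2) (TPoly K)) (hc 2)
  simp only [cross_apply] at h0 h1 h2
  simp at h0 h1 h2
  rw [Matrix.det_fin_three]
  cases D with
  | DA =>
    simp [DetOp.factor, DetOp.row, Fin.sum_univ_three]
    linear_combination X 0 * (scroll A B (H 0) * h0 + scroll A B (H 1) * h1
      + scroll A B (H 2) * h2)
  | DB =>
    simp [DetOp.factor, DetOp.row, Fin.sum_univ_three]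
    linear_combination -X 1 * (scroll A B (H 0) * h0 + scroll A B (H 1) * h1
      + scroll A B (H 2) * h2)

theorem IsIterate.scroll_eq {p A B : Fin 3 → TPoly K} {c : K}
    (hc : ∀ i, (A ⨯₃ B) i = C c * p i) : ∀ {w : List DetOp} {F G : TZPoly K},
    IsIterate p A B w F G → scroll A B G = (w.map (DetOp.factor c)).prod * scroll A B F
  | [], _, _, h => by
    obtain rfl : _ = _ := h
    simp
  | D :: w, F, G, ⟨_, hv, hw⟩ => by
    rw [hw.scroll_eq hc, hv.scroll_eq hc, List.map_cons, List.prod_cons]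
    ring

theorem DetOp.factor_ne_zero {c : K} (hc : c ≠ 0) (D : DetOp) : D.factor c ≠ 0 := by
  cases D <;> simp [DetOp.factor, hc, X_ne_zero]

/-- Nonvanishing on the scroll is the invariant: it survives each step, and it forces `F ≠ 0`, so
the bidegree of every value is known. -/
theorem iterateDefined_cons {p A B : Fin 3 → TPoly K} {μ μ₁ μ₂ n k : ℕ} {c : K}
    (hp : ∀ i, (p i).IsHomogeneous μ) (hAB : IsMuBasis p μ₁ μ₂ A B) (hμ : μ = μ₁ + μ₂)
    (hμ₂ : 0 < μ₂) (hc : c ≠ 0) (hABp : ∀ i, (A ⨯₃ B) i = C c * p i) {D : DetOp}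
    {w : List DetOp} {F : TZPoly K} (hF : IsBihomogeneous F (n, k)) (hF0 : scroll A B F ≠ 0)
    (hn : μ + μ₂ ≤ n + 1)
    (hw : ∀ n' G, n' + D.drop μ₁ μ₂ = n → IsBihomogeneous G (n', k + 1) →
      scroll A B G ≠ 0 → IterateDefined p A B w G) :
    IterateDefined p A B (D :: w) F := by
  constructor
  · obtain ⟨H, hH, hFH⟩ := exists_bihomogeneous_presentation
      (fun g hg => hAB.exists_presentation hp hμ hμ₂ hn hg) hF
    exact ⟨_, H, ⟨_, hH⟩, hFH, rfl⟩
  · intro G hG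
    obtain ⟨n', hn', hG'⟩ := hG.isBihomogeneous hp hAB hμ hF (by rintro rfl; simp at hF0)
    exact hw n' G hn' hG' (hG.scroll_eq hABp ▸ mul_ne_zero (D.factor_ne_zero hc) hF0)

/-- The range depends on `d` and `μ` only through `d - μ`, the degree of `q` in `T`, so `n + μ`
plays the role of `d` for a polynomial of degree `n`. The degree only drops, so the bound needed at
the last operator implies all earlier ones. -/
theorem iterateDefined_word {p A B : Fin 3 → TPoly K} {μ μ₁ μ₂ : ℕ} {c : K}
    (hp : ∀ i, (p i).IsHomogeneous μ) (hAB : IsMuBasis p μ₁ μ₂ A B) (hμ : μ = μ₁ + μ₂)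
    (hμ₂ : 0 < μ₂) (hc : c ≠ 0) (hABp : ∀ i, (A ⨯₃ B) i = C c * p i) (b : ℕ) :
    ∀ (a n k : ℕ) (F : TZPoly K), IsBihomogeneous F (n, k) → scroll A B F ≠ 0 →
      InRange (n + μ) μ μ₁ μ₂ a b → IterateDefined p A B (word a b) F := by
  have hle := hAB.le
  induction b with
  | zero =>
    intro a
    induction a with
    | zero => exact fun _ _ _ _ _ _ => trivial
    | succ a ih =>
      intro n k F hF hF0 hr
      simp only [InRange] at hr
      push_cast at hr
      have ha : (0 : ℤ) ≤ a * μ₁ := by positivity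
      refine iterateDefined_cons hp hAB hμ hμ₂ hc hABp hF hF0 ?_ fun n' G hn' hG hG0 => ?_
      · zify; lia
      · refine ih n' _ G hG hG0 (Or.inr ⟨rfl, ?_⟩)
        simp only [DetOp.drop] at hn'
        push_cast
        lia
  | succ b ihb =>
    intro a
    induction a with
    | zero =>
      intro n k F hF hF0 hr
      simp only [InRange] at hr
      push_cast at hr
      have hb : (0 : ℤ) ≤ b * μ₂ := by positivity
      refine iterateDefined_cons hp hAB hμ hμ₂ hc hABp hF hF0 ?_ fun n' G hn' hG hG0 => ?_
      · zify; lia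
      -- After the last `D_B` the word is empty; the range condition for `b = 0` is stronger than
      -- what is known and is not needed.
      · rcases b with _ | b
        · trivial
        · refine ihb 0 n' _ G hG hG0 (Or.inl ⟨by omega, ?_⟩)
          simp only [DetOp.drop] at hn'
          push_cast at hr ⊢
          lia
    | succ a ih =>
      intro n k F hF hF0 hr
      simp only [InRange] at hr
      push_cast at hr
      have ha : (0 : ℤ) ≤ a * μ₁ := by positivity
      have hb : (0 : ℤ) ≤ b * μ₂ := by positivity
      refine iterateDefined_cons hp hAB hμ hμ₂ hc hABp hF hF0 ?_ fun n' G hn' hG hG0 => ?_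
      · zify; lia
      · refine ih n' _ G hG hG0 (Or.inl ⟨by omega, ?_⟩)
        simp only [DetOp.drop] at hn'
        push_cast
        lia

end Scroll

/-! ### Minimal bihomogeneous generators and the graded Nakayama lemma. -/

section MinimalGenerators

variable {K : Type*} [Field K]

/-- The `K`-subspace `⟨T, Z⟩ I`, for a bihomogeneous ideal `I`. -/
def irrelevantMul (I : Ideal (TZPoly K)) : Submodule K (TZPoly K) :=
  Submodule.span K {F | ∃ i, ∃ k ∈ I, (∃ m, IsBihomogeneous k m) ∧ F = X i * k}

/-- The ideal contains the bihomogeneous components of its elements. -/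
def IsBihomogeneousIdeal (I : Ideal (TZPoly K)) : Prop :=
  ∀ F ∈ I, ∀ m, weightedHomogeneousComponent bidegree m F ∈ I

theorem weightedHomogeneousComponent_bidegree_isBihomogeneous (m : ℕ × ℕ) (F : TZPoly K) :
    IsBihomogeneous (weightedHomogeneousComponent bidegree m F) m :=
  weightedHomogeneousComponent_isWeightedHomogeneous m F

namespace IsBihomogeneousIdeal

variable {I : Ideal (TZPoly K)}

theorem X_mul_mem (hI : IsBihomogeneousIdeal I) (i : Fin 2 ⊕ Fin 3) {F : TZPoly K}
    (hF : F ∈ I) : X i * F ∈ irrelevantMul I := by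
  rw [← sum_weightedHomogeneousComponent bidegree F]
  refine finsum_induction (fun G => X i * G ∈ irrelevantMul I) (by simp) ?_ ?_
  · intro G H hG hH
    rw [mul_add]
    exact add_mem hG hH
  · exact fun m => Submodule.subset_span ⟨i, _, hI F hF m,
      ⟨m, weightedHomogeneousComponent_bidegree_isBihomogeneous m F⟩, rfl⟩

/-- The ring acts on `I/⟨T, Z⟩I` through the constant coefficient, so ideal generators of `I` span
this quotient over `K`. -/
theorem mul_sub_mem (hI : IsBihomogeneousIdeal I) {F : TZPoly K} (hF : F ∈ I) (h : TZPoly K) :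
    h * F - constantCoeff h • F ∈ irrelevantMul I := by
  induction h using MvPolynomial.induction_on with
  | C a => simp [smul_eq_C_mul]
  | add g h hg hh =>
    convert add_mem hg hh using 1
    rw [map_add, add_smul]
    ring
  | mul_X h i _ =>
    convert hI.X_mul_mem i (I.mul_mem_left h hF) using 1
    simp
    ring

theorem mkQ_mem_span (hI : IsBihomogeneousIdeal I) {N : Set (TZPoly K)} (hN : Ideal.span N = I)
    {F : TZPoly K} (hF : F ∈ I) :
    (irrelevantMul I).mkQ F ∈ Submodule.span K ((irrelevantMul I).mkQ '' N) := by
  subst hN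
  refine Submodule.span_induction (fun x hx => Submodule.subset_span ⟨x, hx, rfl⟩) (by simp)
    (fun x y _ _ hx hy => by rw [map_add]; exact add_mem hx hy) (fun a x hx h => ?_) hF
  have : (irrelevantMul (Ideal.span N)).mkQ (a • x) =
      constantCoeff a • (irrelevantMul (Ideal.span N)).mkQ x := by
    rw [← map_smul, ← sub_eq_zero, ← map_sub]
    exact (Submodule.Quotient.mk_eq_zero _).mpr (hI.mul_sub_mem hx a)
  rw [this]
  exact Submodule.smul_mem _ _ h

/-- Graded Nakayama lemma. -/
theorem le_span (hI : IsBihomogeneousIdeal I) {M : Set (TZPoly K)}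
    (hM : ∀ F ∈ M, ∃ m, IsBihomogeneous F m)
    (hspan : ∀ F ∈ I, ∀ m, IsBihomogeneous F m →
      (irrelevantMul I).mkQ F ∈ Submodule.span K ((irrelevantMul I).mkQ '' M)) :
    I ≤ Ideal.span M := by
  have key : ∀ (n : ℕ) (m : ℕ × ℕ), m.1 + m.2 = n → ∀ F ∈ I, IsBihomogeneous F m →
      F ∈ Ideal.span M := by
    intro n
    induction n using Nat.strong_induction_on with
    | _ n ih =>
    intro m hmn F hFI hF
    have h1 := hspan F hFI m hF
    rw [← Submodule.map_span] at h1
    obtain ⟨G, hG, hGF⟩ := h1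
    have h2 : F - G ∈ irrelevantMul I := by
      rw [← Submodule.Quotient.mk_eq_zero, ← Submodule.mkQ_apply, map_sub, hGF, sub_self]
    -- The component of `G` of bidegree `m` stays in the span of `M` since `M` is bihomogeneous.
    -- That of `F - G` is a combination of products `X i * k` with `k` in `I` of smaller total
    -- degree, where induction applies.
    have hFm : F = weightedHomogeneousComponent bidegree m G +
        weightedHomogeneousComponent bidegree m (F - G) := by
      rw [← map_add, add_sub_cancel, IsWeightedHomogeneous.weightedHomogeneousComponent_same hF]
    rw [hFm]
    refine add_mem ?_ ?_
    · refine Submodule.span_induction (p := fun G _ =>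
        weightedHomogeneousComponent bidegree m G ∈ Ideal.span M) (fun x hx => ?_) (by simp)
        (fun x y _ _ hx hy => by rw [map_add]; exact add_mem hx hy)
        (fun a x _ hx => by
          rw [map_smul, smul_eq_C_mul]
          exact Ideal.mul_mem_left _ _ hx) hG
      obtain ⟨k, hk⟩ := hM x hx
      rw [weightedHomogeneousComponent_of_mem hk]
      split_ifs
      · exact Ideal.subset_span hx
      · exact zero_mem _
    · refine Submodule.span_induction (p := fun G _ =>
        weightedHomogeneousComponent bidegree m G ∈ Ideal.span M) ?_ (by simp)
        (fun x y _ _ hx hy => by rw [map_add]; exact add_mem hx hy)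
        (fun a x _ hx => by
          rw [map_smul, smul_eq_C_mul]
          exact Ideal.mul_mem_left _ _ hx) h2
      rintro _ ⟨i, k, hk, ⟨m', hm'⟩, rfl⟩
      have hX : IsBihomogeneous (X i * k) (bidegree i + m') :=
        IsBihomogeneous.mul (isWeightedHomogeneous_X _ _ i) hm' rfl
      rw [weightedHomogeneousComponent_of_mem hX]
      split_ifs with h
      · refine Ideal.mul_mem_left _ _ (ih (m'.1 + m'.2) ?_ m' rfl k hk hm')
        rw [← hmn, h]
        rcases i with i | i <;> simp
      · exact zero_mem _
  intro F hF
  rw [← sum_weightedHomogeneousComponent bidegree F]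
  exact finsum_induction (· ∈ Ideal.span M) (zero_mem _) (fun _ _ => add_mem)
    fun m => key _ m rfl _ (hI F hF m)
      (weightedHomogeneousComponent_bidegree_isBihomogeneous m F)

/-- The set `S` is completed by bihomogeneous elements of `I` to a family that maps to a basis of
`I/⟨T, Z⟩I`. It generates `I` by Nakayama, and a generating subset already spans the quotient, so
independence leaves no room to omit an element. -/
theorem exists_isMinimalGenerators (hI : IsBihomogeneousIdeal I) {S : Set (TZPoly K)}
    (hSI : S ⊆ I) (hS : ∀ F ∈ S, ∃ m, IsBihomogeneous F m)
    (hli : LinearIndepOn K (irrelevantMul I).mkQ S) :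
    ∃ M, IsMinimalGenerators I M ∧ S ⊆ M := by
  obtain ⟨M, hMt, hSM, htM, hMli⟩ := exists_linearIndepOn_extension
    (t := {F | F ∈ I ∧ ∃ m, IsBihomogeneous F m}) hli fun F hF => ⟨hSI hF, hS F hF⟩
  have hM : ∀ F ∈ M, ∃ m, IsBihomogeneous F m := fun F hF => (hMt hF).2
  refine ⟨M, ⟨hM, le_antisymm (Ideal.span_le.mpr fun F hF => (hMt hF).1)
    (hI.le_span hM fun F hF m hm => htM ⟨F, ⟨hF, m, hm⟩, rfl⟩), fun N hNM hN => ?_⟩, hSM⟩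
  refine hNM.antisymm fun F hF => ?_
  by_contra hFN
  exact ((hMli.mono hNM).notMem_span_iff.mpr
    ⟨hMli.mono (Set.insert_subset hF hNM), hFN⟩) (hI.mkQ_mem_span hN (hMt hF).1)

end IsBihomogeneousIdeal

end MinimalGenerators

/-! ### The moving curve ideal is bihomogeneous. -/

section ReesMap

variable {K : Type*} [Field K]

theorem exists_reesMap_monomial {d : ℕ} {f : Fin 3 → TPoly K} (hf : ∀ i, (f i).IsHomogeneous d)
    (e : Fin 2 ⊕ Fin 3 →₀ ℕ) (c : K) :
    ∃ t : TPoly K, t.IsHomogeneous (∑ i, e (Sum.inl i) + (∑ j, e (Sum.inr j)) * d) ∧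
      reesMap f (monomial e c) = Polynomial.monomial (∑ j, e (Sum.inr j)) t := by
  refine ⟨C c * ((∏ i, X i ^ e (Sum.inl i)) * ∏ j, f j ^ e (Sum.inr j)), ?_, ?_⟩
  · refine IsHomogeneous.C_mul (IsHomogeneous.mul ?_ ?_) c
    · exact IsHomogeneous.prod _ _ _ fun i _ => by
        simpa using (isHomogeneous_X K i).pow (e (Sum.inl i))
    · rw [Finset.sum_mul]
      exact IsHomogeneous.prod _ _ _ fun j _ => by
        simpa [mul_comm] using (hf j).pow (e (Sum.inr j))
  · rw [reesMap, aeval_monomial, Finsupp.prod_fintype _ _ (by simp), Fintype.prod_sum_type,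
      ← Polynomial.C_mul_X_pow_eq_monomial]
    simp [Fin.prod_univ_three, Fin.sum_univ_three, mul_pow, pow_add,
      Polynomial.algebraMap_apply]
    ring

/-- The map `ψ` is graded: bidegree `(i, j)` goes to forms of degree `i + j d` times `s ^ j`. Hence
its kernel contains the components of its elements. -/
theorem reesMap_weightedHomogeneousComponent {d : ℕ} {f : Fin 3 → TPoly K}
    (hf : ∀ i, (f i).IsHomogeneous d) (m : ℕ × ℕ) (F : TZPoly K) :
    reesMap f (weightedHomogeneousComponent bidegree m F) =
      Polynomial.monomial m.2
        (homogeneousComponent (m.1 + m.2 * d) ((reesMap f F).coeff m.2)) := by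
  induction F using MvPolynomial.induction_on' with
  | add p q hp hq => simp [hp, hq]
  | monomial e c =>
    obtain ⟨t, ht, hte⟩ := exists_reesMap_monomial hf e c
    rw [weightedHomogeneousComponent_of_mem (isWeightedHomogeneous_monomial bidegree e c rfl),
      weight_bidegree, hte, Polynomial.coeff_monomial]
    obtain ⟨i, j⟩ := m
    by_cases hj : ∑ j, e (Sum.inr j) = j
    · subst hj
      rw [if_pos rfl, homogeneousComponent_of_mem ht]
      by_cases hi : i = ∑ i, e (Sum.inl i)
      · simp [hi, hte]
      · rw [if_neg (by simpa using hi), if_neg (by simpa using hi)]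
        simp
    · rw [if_neg hj, if_neg fun h => hj (Prod.ext_iff.mp h).2.symm]
      simp

theorem isBihomogeneousIdeal_movingCurveIdeal {d : ℕ} {f : Fin 3 → TPoly K}
    (hf : ∀ i, (f i).IsHomogeneous d) : IsBihomogeneousIdeal (movingCurveIdeal f) := by
  intro F hF m
  rw [movingCurveIdeal, RingHom.mem_ker] at hF ⊢
  rw [reesMap_weightedHomogeneousComponent hf, hF]
  simp

end ReesMap

/-! ### The moving curve ideal as the preimage of the ideal generated by `L`. -/

section Divisibility

variable {K : Type*} [Field K]

open Matrix

/-- Substitution of `z` for the variables `Z`. -/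
def substZ (z : Fin 3 → MvPolynomial (Fin 2) (TPoly K)) :
    TZPoly K →ₐ[K] MvPolynomial (Fin 2) (TPoly K) :=
  aeval (Sum.elim (fun i => C (X i)) z)

theorem substZ_mul {m : ℕ × ℕ} {F : TZPoly K} (hF : IsBihomogeneous F m)
    (a : MvPolynomial (Fin 2) (TPoly K)) (z : Fin 3 → MvPolynomial (Fin 2) (TPoly K)) :
    substZ (fun j => a * z j) F = a ^ m.2 * substZ z F := by
  rw [as_sum F, map_sum, map_sum, Finset.mul_sum]
  refine Finset.sum_congr rfl fun e he => ?_
  have hw := hF (mem_support_iff.mp he)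
  rw [weight_bidegree] at hw
  rw [← hw]
  simp only [substZ, aeval_monomial]
  rw [Finsupp.prod_fintype _ _ (by simp), Fintype.prod_sum_type,
    Finsupp.prod_fintype _ _ (by simp), Fintype.prod_sum_type]
  simp only [Sum.elim_inl, Sum.elim_inr, mul_pow, Finset.prod_mul_distrib,
    Finset.prod_pow_eq_pow_sum]
  ring

theorem dvd_substZ_sub {a : MvPolynomial (Fin 2) (TPoly K)}
    {y z : Fin 3 → MvPolynomial (Fin 2) (TPoly K)} (h : ∀ j, a ∣ y j - z j) (F : TZPoly K) :
    a ∣ substZ y F - substZ z F := by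
  induction F using MvPolynomial.induction_on with
  | C c => simp [substZ]
  | add f g hf hg =>
    convert dvd_add hf hg using 1
    rw [map_add, map_add]
    ring
  | mul_X f i hf =>
    rw [map_mul, map_mul]
    rcases i with i | j
    · convert hf.mul_right (C (X i)) using 1
      simp [substZ, sub_mul]
    · convert dvd_add (hf.mul_right (y j)) ((h j).mul_left (substZ z f)) using 1
      have hy : substZ y (X (Sum.inr j)) = y j := by simp [substZ]
      have hz : substZ z (X (Sum.inr j)) = z j := by simp [substZ]
      rw [hy, hz]
      ring

theorem substZ_mul_C_eq_eval₂ (f : Fin 3 → TPoly K) (g : MvPolynomial (Fin 2) (TPoly K))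
    (F : TZPoly K) : substZ (fun j => g * C (f j)) F = (reesMap f F).eval₂ C g := by
  induction F using MvPolynomial.induction_on with
  | C c =>
    have : reesMap f (C c) = Polynomial.C (C c) := (reesMap f).commutes c
    rw [this, Polynomial.eval₂_C]
    exact (substZ _).commutes c
  | add f g hf hg => simp [hf, hg]
  | mul_X F i hF =>
    rw [map_mul, map_mul, Polynomial.eval₂_mul, hF]
    rcases i with i | j
    · simp [substZ, reesMap]
    · simp [substZ, reesMap, mul_comm g]

variable {f q A B : Fin 3 → TPoly K} {e : K}

/-- Modulo `L = αx + βy`, the point `xA + yB` becomes `e y f` after multiplication by `α` and `-e x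
f` after multiplication by `β`. A form `G` in `I` of degree `k` in `Z` vanishes at multiples of `f`,
so `L` divides both `α^k G` and `β^k G` on the scroll, and `α^k`, `β^k` are coprime. -/
theorem lineForm_dvd_scroll_of_mem {d : ℕ} (hf : ∀ i, (f i).IsHomogeneous d)
    (he : ∀ i, (A ⬝ᵥ q) * B i - (B ⬝ᵥ q) * A i = C e * f i)
    (hAB : IsRelPrime (A ⬝ᵥ q) (B ⬝ᵥ q)) {F : TZPoly K} (hF : F ∈ movingCurveIdeal f) :
    lineForm A B q ∣ scroll A B F := by
  suffices key : ∀ m G, IsBihomogeneous G m → G ∈ movingCurveIdeal f →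
      lineForm A B q ∣ scroll A B G by
    rw [← sum_weightedHomogeneousComponent bidegree F]
    refine finsum_induction (lineForm A B q ∣ scroll A B ·) (by simp) ?_ ?_
    · intro G H hG hH
      rw [map_add]
      exact dvd_add hG hH
    · exact fun m => key m _ (weightedHomogeneousComponent_bidegree_isBihomogeneous m F)
        (isBihomogeneousIdeal_movingCurveIdeal hf F hF m)
  intro m G hG hGf
  have main : ∀ a g : MvPolynomial (Fin 2) (TPoly K),
      (∀ j, lineForm A B q ∣ a * (C (A j) * X 0 + C (B j) * X 1) - g * C (f j)) →
      lineForm A B q ∣ a ^ m.2 * scroll A B G := by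
    intro a g h
    have h1 := dvd_substZ_sub h G
    rwa [substZ_mul hG, substZ_mul_C_eq_eval₂, (RingHom.mem_ker).mp hGf, Polynomial.eval₂_zero,
      sub_zero] at h1
  have heC : ∀ j, C (A ⬝ᵥ q) * C (B j) - C (B ⬝ᵥ q) * C (A j) =
      (C (C e) * C (f j) : MvPolynomial (Fin 2) (TPoly K)) := fun j => by
    simp only [← map_mul, ← map_sub, he]
  refine dvd_of_dvd_mul_of_isRelPrime ((isRelPrime_C hAB).pow (m := m.2) (n := m.2))
    (main _ (X 1 * C (C e)) fun j => ⟨C (A j), ?_⟩)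
    (main _ (-(X 0 * C (C e))) fun j => ⟨C (B j), ?_⟩)
  · rw [lineForm]
    linear_combination X 1 * heC j
  · rw [lineForm]
    linear_combination -X 0 * heC j

theorem mem_of_lineForm_dvd_scroll (he0 : e ≠ 0)
    (he : ∀ i, (A ⬝ᵥ q) * B i - (B ⬝ᵥ q) * A i = C e * f i) {F : TZPoly K}
    (hF : lineForm A B q ∣ scroll A B F) : F ∈ movingCurveIdeal f := by
  -- The zero `(x, y) = e⁻¹ s (-β, α)` of `L` is the point where `xA + yB = f s`; thus `ψ` factors
  -- through the scroll and `L` maps to `0`.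
  let χ : MvPolynomial (Fin 2) (TPoly K) →+* Polynomial (TPoly K) :=
    eval₂Hom Polynomial.C ![-(Polynomial.C (C e⁻¹ * B ⬝ᵥ q) * Polynomial.X),
      Polynomial.C (C e⁻¹ * A ⬝ᵥ q) * Polynomial.X]
  have hχ : ∀ G, reesMap f G = χ (scroll A B G) := by
    intro G
    induction G using MvPolynomial.induction_on with
    | C c =>
      have : reesMap f (C c) = Polynomial.C (C c) := (reesMap f).commutes c
      simp [this, χ]
    | add G H hG hH => simp [hG, hH]
    | mul_X G i hG =>
      rw [map_mul, map_mul, map_mul, hG]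
      congr 1
      rcases i with i | j
      · simp [χ, reesMap]
      · have h1 : f j = C e⁻¹ * ((A ⬝ᵥ q) * B j - (B ⬝ᵥ q) * A j) := by
          rw [he, ← mul_assoc, ← map_mul, inv_mul_cancel₀ he0, map_one, one_mul]
        simp only [χ, reesMap, scroll_Z, aeval_X, Sum.elim_inr, h1]
        simp
        ring
  rw [movingCurveIdeal, RingHom.mem_ker]
  change reesMap f F = 0
  obtain ⟨r, hr⟩ := hF
  rw [hχ, hr, map_mul]
  have : χ (lineForm A B q) = 0 := by
    simp [χ, lineForm]
    ring
  rw [this, zero_mul]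

/-- The image of `⟨T, Z⟩ K` on the scroll vanishes at `T = 0` after division by `q`. -/
theorem exists_scroll_eq_of_mem_irrelevantMul {d : ℕ} (hf : ∀ i, (f i).IsHomogeneous d)
    (he : ∀ i, (A ⬝ᵥ q) * B i - (B ⬝ᵥ q) * A i = C e * f i)
    (hAB : IsRelPrime (A ⬝ᵥ q) (B ⬝ᵥ q)) (hA : ∀ i, constantCoeff (A i) = 0)
    (hB : ∀ i, constantCoeff (B i) = 0) {F : TZPoly K}
    (hF : F ∈ irrelevantMul (movingCurveIdeal f)) :
    ∃ g, scroll A B F = g * lineForm A B q ∧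
      MvPolynomial.map (constantCoeff : TPoly K →+* K) g = 0 := by
  refine Submodule.span_induction ?_ ⟨0, by simp⟩ ?_ ?_ hF
  · rintro _ ⟨i, k, hk, -, rfl⟩
    obtain ⟨r, hr⟩ := lineForm_dvd_scroll_of_mem hf he hAB hk
    refine ⟨scroll A B (X i) * r, by rw [map_mul, hr]; ring, ?_⟩
    rw [map_mul]
    -- The images `T i` and `A j x + B j y` of the variables vanish at `T = 0`, the latter because
    -- `A` and `B` have no constant terms.
    rcases i with i | j <;> simp [hA, hB]
  · rintro x y - - ⟨g, hg, hg0⟩ ⟨h, hh, hh0⟩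
    exact ⟨g + h, by rw [map_add, hg, hh, add_mul], by rw [map_add, hg0, hh0, add_zero]⟩
  · rintro a x - ⟨g, hg, hg0⟩
    exact ⟨C (C a) * g, by rw [smul_eq_C_mul, map_mul, hg, scroll_C, mul_assoc],
      by rw [map_mul, hg0, mul_zero]⟩

/-- A relation modulo `⟨T, Z⟩I`, divided by `L` and taken at `T = 0`, becomes a relation between
distinct monomials `x^a y^b`. -/
theorem linearIndependent_mkQ {d : ℕ} (hf : ∀ i, (f i).IsHomogeneous d)
    (he : ∀ i, (A ⬝ᵥ q) * B i - (B ⬝ᵥ q) * A i = C e * f i)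
    (hAB : IsRelPrime (A ⬝ᵥ q) (B ⬝ᵥ q)) (hA : ∀ i, constantCoeff (A i) = 0)
    (hB : ∀ i, constantCoeff (B i) = 0) (hQ : lineForm A B q ≠ 0) {c : K} (hc : c ≠ 0)
    {S : Set (ℕ × ℕ)} {G : S → TZPoly K}
    (hG : ∀ s : S, scroll A B (G s) =
      DetOp.factor c .DA ^ s.1.1 * DetOp.factor c .DB ^ s.1.2 * lineForm A B q) :
    LinearIndependent K ((irrelevantMul (movingCurveIdeal f)).mkQ ∘ G) := by
  rw [linearIndependent_iff']
  intro t u hu s hs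
  have h1 : ∑ i ∈ t, u i • G i ∈ irrelevantMul (movingCurveIdeal f) := by
    rw [← Submodule.Quotient.mk_eq_zero, ← Submodule.mkQ_apply, map_sum, ← hu]
    simp
  obtain ⟨g, hg, hg0⟩ := exists_scroll_eq_of_mem_irrelevantMul hf he hAB hA hB h1
  have h2 : ∑ i ∈ t, C (C (u i)) *
      (DetOp.factor c .DA ^ i.1.1 * DetOp.factor c .DB ^ i.1.2) = g := by
    apply mul_right_cancel₀ hQ
    rw [← hg, map_sum, Finset.sum_mul]
    refine Finset.sum_congr rfl fun i _ => ?_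
    rw [smul_eq_C_mul, map_mul, scroll_C, hG, mul_assoc, mul_assoc]
  have h3 : ∑ i ∈ t, monomial (Finsupp.single 0 i.1.1 + Finsupp.single 1 i.1.2)
      (u i * (c ^ i.1.1 * (-c) ^ i.1.2)) = (0 : MvPolynomial (Fin 2) K) := by
    rw [← hg0, ← h2, map_sum]
    refine Finset.sum_congr rfl fun i _ => ?_
    rw [monomial_eq]
    simp [DetOp.factor, mul_pow, Finsupp.prod_add_index', pow_add]
    ring
  have h4 := congrArg (coeff (Finsupp.single 0 s.1.1 + Finsupp.single 1 s.1.2)) h3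
  rw [coeff_sum, Finset.sum_eq_single s, coeff_monomial, if_pos rfl, coeff_zero] at h4
  · simpa [hc] using h4
  · intro i _ his
    rw [coeff_monomial, if_neg]
    intro h
    apply his
    have e0 := DFunLike.congr_fun h 0
    have e1 := DFunLike.congr_fun h 1
    simp at e0 e1
    exact Subtype.ext (Prod.ext e0 e1)
  · exact fun h => absurd hs h

end Divisibility

/-! ### The relation between `A`, `B`, `q` and `f`. -/

section MuBasis

variable {K : Type*} [Field K]

open Matrix

theorem isHomogeneous_dotProduct {g h : Fin 3 → TPoly K} {m n : ℕ}
    (hg : ∀ i, (g i).IsHomogeneous m) (hh : ∀ i, (h i).IsHomogeneous n) :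
    (g ⬝ᵥ h).IsHomogeneous (m + n) :=
  IsHomogeneous.sum _ _ _ fun i _ => (hg i).mul (hh i)

/-- The vector `αB - βA` is orthogonal to `p` and `q` and has degree `d`, so it is a constant times
`f`. If the constant were `0`, independence of `A, B` would give `α = β = 0`; then `p` and `q` would
both be orthogonal to `A` and `B`, hence parallel. -/
theorem exists_dotProduct_mul_sub_eq {d μ μ₁ μ₂ : ℕ} {f p q A B : Fin 3 → TPoly K}
    (hf : ∀ i, (f i).IsHomogeneous d)
    (hgcd : ∀ g : TPoly K, (∀ i, g ∣ f i) → IsUnit g)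
    (hpq : IsMuBasis f μ (d - μ) p q) (hAB : IsMuBasis p μ₁ μ₂ A B) (hμ : μ = μ₁ + μ₂)
    (hμd : μ ≤ d) :
    ∃ e : K, e ≠ 0 ∧ ∀ i, (A ⬝ᵥ q) * B i - (B ⬝ᵥ q) * A i = C e * f i := by
  have hpq0 := cross_ne_zero_of_linearIndependent hpq.linearIndependent
  have hAB0 := cross_ne_zero_of_linearIndependent hAB.linearIndependent
  have hα := isHomogeneous_dotProduct hAB.homogeneous_fst hpq.homogeneous_snd
  have hβ := isHomogeneous_dotProduct hAB.homogeneous_snd hpq.homogeneous_snd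
  have hp : p ⬝ᵥ ((A ⬝ᵥ q) • B - (B ⬝ᵥ q) • A) = 0 := by
    rw [dotProduct_sub, dotProduct_smul, dotProduct_smul, dotProduct_comm p B,
      dotProduct_comm p A, hAB.fst_dotProduct, hAB.snd_dotProduct]
    simp
  have hq : q ⬝ᵥ ((A ⬝ᵥ q) • B - (B ⬝ᵥ q) • A) = 0 := by
    rw [dotProduct_sub, dotProduct_smul, dotProduct_smul, dotProduct_comm q B,
      dotProduct_comm q A, smul_eq_mul, smul_eq_mul]
    ring
  obtain ⟨e, he⟩ := eq_C_mul_of_cross_eq_zero (g := (A ⬝ᵥ q) • B - (B ⬝ᵥ q) • A) hf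
    (fun i => by
      refine IsHomogeneous.sub ?_ ?_
      · exact (show μ₁ + (d - μ) + μ₂ = d by omega) ▸ hα.mul (hAB.homogeneous_snd i)
      · exact (show μ₂ + (d - μ) + μ₁ = d by omega) ▸ hβ.mul (hAB.homogeneous_fst i)) hgcd
    (cross_eq_zero_of_orthogonal hpq0 hpq.fst_dotProduct hpq.snd_dotProduct hp hq)
  refine ⟨e, ?_, he⟩
  rintro rfl
  have h0 := LinearIndependent.pair_iff.mp hAB.linearIndependent (-(B ⬝ᵥ q)) (A ⬝ᵥ q) (by
    ext1 i
    have := he i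
    simp at this ⊢
    linear_combination this)
  exact hpq0 (cross_eq_zero_of_orthogonal hAB0 hAB.fst_dotProduct hAB.snd_dotProduct h0.2
    (neg_eq_zero.mp h0.1))

end MuBasis

end MovingCurve

end

/-! ### Independence of the iterates of `q` and the minimal generating set. -/

theorem theorem5p9 {K : Type*} [Field K] (d μ μ₁ μ₂ : ℕ)
    (f p q A B : Fin 3 → MovingCurve.TPoly K)
    (hf : ∀ i, (f i).IsHomogeneous d)
    (hgcd : ∀ g : MovingCurve.TPoly K, (∀ i, g ∣ f i) → IsUnit g)
    (hpq : MovingCurve.IsMuBasis f μ (d - μ) p q)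
    (hAB : MovingCurve.IsMuBasis p μ₁ μ₂ A B)
    (hμ : μ = μ₁ + μ₂)
    (hμ₁ : 0 < μ₁) :
    -- the iterates are defined, whatever choices are made on the way
    (∀ a b : ℕ, MovingCurve.InRange d μ μ₁ μ₂ a b →
      MovingCurve.IterateDefined p A B (MovingCurve.word a b) (MovingCurve.movingLine q)) ∧
    -- any choice of values, for each `(a, b)` and any order of the `a + b` operators
    (∀ G : ℕ → ℕ → MovingCurve.TZPoly K,
      (∀ a b : ℕ, MovingCurve.InRange d μ μ₁ μ₂ a b →
        ∃ w : List MovingCurve.DetOp, w.Perm (MovingCurve.word a b) ∧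
          MovingCurve.IsIterate p A B w (MovingCurve.movingLine q) (G a b)) →
      Set.InjOn (fun c : ℕ × ℕ => G c.1 c.2)
        {c | MovingCurve.InRange d μ μ₁ μ₂ c.1 c.2} ∧
      ∃ M : Set (MovingCurve.TZPoly K),
        MovingCurve.IsMinimalGenerators (MovingCurve.movingCurveIdeal f) M ∧
        ∀ a b : ℕ, MovingCurve.InRange d μ μ₁ μ₂ a b → G a b ∈ M) := by
  have hle := hAB.le
  -- The subtraction in `d - μ` is truncated, but `d < μ` would turn `μ ≤ d - μ` into `μ ≤ 0`.
  have hμd : μ ≤ d := by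
    have := hpq.le
    omega
  obtain ⟨c, hc0, hc⟩ := hAB.exists_cross_eq hpq.homogeneous_fst
    hpq.isUnit_of_forall_dvd_fst hμ
  obtain ⟨e, he0, he⟩ := MovingCurve.exists_dotProduct_mul_sub_eq hf hgcd hpq hAB hμ hμd
  -- A common divisor of `α` and `β` divides `αB - βA`, hence every entry of `f`.
  have hrel : IsRelPrime (dotProduct A q) (dotProduct B q) := fun h h1 h2 =>
    hgcd h fun i => by
      have h3 : h ∣ MvPolynomial.C e * f i := he i ▸
        dvd_sub (h1.mul_right _) (h2.mul_right _)
      exact ((he0.isUnit.map MvPolynomial.C).dvd_mul_left).mp h3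
  have hQ : MovingCurve.lineForm A B q ≠ 0 := by
    intro h0
    have h1 := congrArg (MvPolynomial.eval ![1, 0]) h0
    have h2 := congrArg (MvPolynomial.eval ![0, 1]) h0
    simp [MovingCurve.lineForm] at h1 h2
    rw [h1, h2] at hrel
    exact not_isUnit_zero (hrel dvd_rfl dvd_rfl)
  have hq := MovingCurve.isBihomogeneous_movingLine hpq.homogeneous_snd
  refine ⟨fun a b hab => MovingCurve.iterateDefined_word hpq.homogeneous_fst hAB hμ
    (by omega) hc0 hc b a (d - μ) 1 _ hq ?_ ?_, fun G hG => ?_⟩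
  · rwa [MovingCurve.scroll_movingLine]
  · rwa [Nat.sub_add_cancel hμd]
  have hconst : ∀ (n : ℕ) (g : MovingCurve.TPoly K), 0 < n → g.IsHomogeneous n →
      MvPolynomial.constantCoeff g = 0 := fun n g hn hg => by
    rw [MvPolynomial.constantCoeff_eq]
    exact hg.coeff_eq_zero (by simpa using hn.ne)
  have hscroll : ∀ a b, MovingCurve.InRange d μ μ₁ μ₂ a b → MovingCurve.scroll A B (G a b) =
      MovingCurve.DetOp.factor c .DA ^ a * MovingCurve.DetOp.factor c .DB ^ b *
        MovingCurve.lineForm A B q := fun a b hab => by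
    obtain ⟨w, hw, hit⟩ := hG a b hab
    -- The factors commute, so only the numbers of `D_A` and `D_B` in `w` matter.
    rw [hit.scroll_eq hc, (hw.map _).prod_eq, MovingCurve.scroll_movingLine]
    simp [MovingCurve.word]
  have hli := MovingCurve.linearIndependent_mkQ hf he hrel
    (fun i => hconst _ _ hμ₁ (hAB.homogeneous_fst i))
    (fun i => hconst _ _ (hμ₁.trans_le hle) (hAB.homogeneous_snd i)) hQ hc0
    (S := {s | MovingCurve.InRange d μ μ₁ μ₂ s.1 s.2}) (G := fun s => G s.1.1 s.1.2)
    fun s => hscroll _ _ s.2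
  -- Distinctness holds even modulo `⟨T, Z⟩I`, as an independent family is injective.
  have hinj := hli.injective.of_comp
  obtain ⟨M, hM, hGM⟩ :=
    (MovingCurve.isBihomogeneousIdeal_movingCurveIdeal hf).exists_isMinimalGenerators
      (Set.range_subset_iff.mpr fun s => MovingCurve.mem_of_lineForm_dvd_scroll he0 he
        ⟨_, (hscroll _ _ s.2).trans (mul_comm _ _)⟩)
      (Set.forall_mem_range.mpr fun s =>
        have ⟨_, _, hit⟩ := hG _ _ s.2
        hit.exists_isBihomogeneous hAB ⟨_, hq⟩)
      ((linearIndepOn_range_iff hinj _).mpr hli)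
  exact ⟨fun s hs t ht hst => congrArg Subtype.val (@hinj ⟨s, hs⟩ ⟨t, ht⟩ hst), M, hM,
    fun a b hab => hGM ⟨⟨(a, b), hab⟩, rfl⟩⟩
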